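/- Let $A$ be a $C^*$-algebra, let $A^{**}$ be its enveloping von Neumann algebra, and regard $A$ and its multiplier algebra $M(A)$ as subalgebras of $A^{**}$. For $a\in A_+$ let $p_a\in A^{**}$ be its range projection. A $\sigma$-compact open projection of $A$ is a projection of the form $p_a$ with $a\in A_+$. For such a projection $p$ put $\mathrm{Her}(p)=pA^{**}p\cap A$. Write $[p]=[q]$ if there is $v\in A^{**}$ with $v^*v=p$, $vv^*=q$ and $vbv^*\in \mathrm{Her}(q)$ for all $b\in \mathrm{Her}(p)$. A precompact support of $p$ is a sequence $\{p_{K,n}\}_{n\ge 1}$ for which there are a strictly positive element $a$ of $\mathrm{Her}(p)$ and numbers $r_n\in(0,\|a\|]$ decreasing to $0$ such that $p_{K,n}$ is the spectral projection of $a$ for $(r_n,\|a\|]$. **Proposition 2.8.** Let $p$ and $q$ be two $\sigma$-compact open projections of $A$, and let $\{p_{K,n}\}$ be a precompact support of $p$. Suppose that there is a norm-continuous path of unitaries $\{w(t): t\in[0,1)\}\subset M(A)$ with $w(0)=1$ such that, for every $n\ge 1$, there is $t_n\in(0,1)$ with $$w(t)p_{K,n}w(t)^*=w(t_n)p_{K,n}w(t_n)^*\quad\text{for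 all } t\in[t_n,1),$$ where $\{w(t_n)p_{K,n}w(t_n)^*\}$ is a precompact support of $q$. Suppose moreover that for every $n\ge 1$ and every $t\in[t_n,1)$ there is $\lambda\in\mathbb{C}$ with $$w(t)p_{K,n}=\lambda\, w(t_n)p_{K,n}.$$ Then $[p]=[q]$. -/

import Mathlib

open Filter Topology
open scoped ENNReal InnerProductSpace ComplexOrder

universe u

/-! ### The universal representation and the enveloping von Neumann algebra -/

section Universal

variable (A : Type u) [NonUnitalCStarAlgebra A] [PartialOrder A] [StarOrderedRing A]

/-- The Hilbert space of the universal representation of `A`: the Hilbert space direct sum of the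
GNS spaces of all positive linear functionals on `A`. -/
abbrev UniversalHilbert : Type u :=
  lp (fun f : A →ₚ[ℂ] ℂ => f.GNS) 2

variable {A}

theorem norm_gns_apply_le (f : A →ₚ[ℂ] ℂ) (a : A) (x : f.GNS) :
    ‖f.gnsNonUnitalStarAlgHom a x‖ ≤ ‖a‖ * ‖x‖ :=
  ((f.gnsNonUnitalStarAlgHom a).le_opNorm x).trans
    (mul_le_mul_of_nonneg_right (NonUnitalStarAlgHom.norm_apply_le _ a) (norm_nonneg x))

theorem memℓp_gns_apply (a : A) (x : UniversalHilbert A) :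
    Memℓp (fun f : A →ₚ[ℂ] ℂ => f.gnsNonUnitalStarAlgHom a (x f)) 2 := by
  have h := (lp.memℓp x).summable (by norm_num)
  refine memℓp_gen ((h.mul_left (‖a‖ ^ (2 : ℝ≥0∞).toReal)).of_nonneg_of_le
    (fun f => by positivity) fun f => ?_)
  rw [← Real.mul_rpow (norm_nonneg _) (norm_nonneg _)]
  exact Real.rpow_le_rpow (norm_nonneg _) (norm_gns_apply_le f a (x f)) (by norm_num)

/-- The operator by which `a` acts in the universal representation (the direct sum of the
operators by which `a` acts on the GNS spaces). -/
noncomputable def universalRepCLM (a : A) : UniversalHilbert A →L[ℂ] UniversalHilbert A :=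
  LinearMap.mkContinuous
    { toFun := fun x => ⟨fun f => f.gnsNonUnitalStarAlgHom a (x f), memℓp_gns_apply a x⟩
      map_add' := fun x y => by ext f; exact map_add (f.gnsNonUnitalStarAlgHom a) (x f) (y f)
      map_smul' := fun c x => by ext f; simp }
    ‖a‖ fun x => by
      refine lp.norm_le_of_tsum_le (by norm_num) (by positivity) ?_
      have h := (lp.memℓp x).summable (by norm_num : 0 < (2 : ℝ≥0∞).toReal)
      rw [Real.mul_rpow (norm_nonneg _) (norm_nonneg _),
        lp.norm_rpow_eq_tsum (by norm_num) x, ← tsum_mul_left]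
      refine Summable.tsum_le_tsum (fun f => ?_)
        ((memℓp_gns_apply a x).summable (by norm_num)) (h.mul_left _)
      rw [← Real.mul_rpow (norm_nonneg _) (norm_nonneg _)]
      exact Real.rpow_le_rpow (norm_nonneg _) (norm_gns_apply_le f a (x f)) (by norm_num)

@[simp]
theorem universalRepCLM_apply (a : A) (x : UniversalHilbert A) (f : A →ₚ[ℂ] ℂ) :
    universalRepCLM a x f = f.gnsNonUnitalStarAlgHom a (x f) := rfl

variable (A)

/-- The universal representation of `A`. -/
noncomputable def universalRep :
    A →⋆ₙₐ[ℂ] (UniversalHilbert A →L[ℂ] UniversalHilbert A) where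
  toFun := universalRepCLM
  map_smul' c a := by ext x f; simp
  map_zero' := by ext x f; simp
  map_add' a b := by ext x f; simp
  map_mul' a b := by ext x f; simp
  map_star' a := by
    refine (ContinuousLinearMap.eq_adjoint_iff _ _).mpr fun x y => ?_
    simp only [lp.inner_eq_tsum, universalRepCLM_apply, map_star]
    refine tsum_congr fun f => ?_
    rw [ContinuousLinearMap.star_eq_adjoint, ContinuousLinearMap.adjoint_inner_left]

/-- The enveloping von Neumann algebra `A**` of `A`: the bicommutant of the image of `A` in its
universal representation. -/
noncomputable def envelopingVN : VonNeumannAlgebra (UniversalHilbert A) where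
  toStarSubalgebra :=
    StarSubalgebra.centralizer ℂ
      (StarSubalgebra.centralizer ℂ (Set.range (universalRep A)) :
        Set (UniversalHilbert A →L[ℂ] UniversalHilbert A))
  centralizer_centralizer' := by
    change Set.centralizer (Set.centralizer (Set.centralizer _)) = Set.centralizer _
    exact Set.centralizer_centralizer_centralizer _

/-- The multiplier algebra `M(A)`, realised inside `A**` as the idealizer of `A`, with the norm
of `A**`. -/
noncomputable def multiplierAlgebra :
    StarSubalgebra ℂ (UniversalHilbert A →L[ℂ] UniversalHilbert A) where
  carrier := {x | x ∈ envelopingVN A ∧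
    (∀ a : A, x * universalRep A a ∈ Set.range (universalRep A)) ∧
    (∀ a : A, universalRep A a * x ∈ Set.range (universalRep A))}
  mul_mem' := by
    rintro x y ⟨hx, hxl, hxr⟩ ⟨hy, hyl, hyr⟩
    refine ⟨mul_mem hx hy, fun a => ?_, fun a => ?_⟩
    · obtain ⟨b, hb⟩ := hyl a
      rw [mul_assoc, ← hb]
      exact hxl b
    · obtain ⟨b, hb⟩ := hxr a
      rw [← mul_assoc, ← hb]
      exact hyr b
  add_mem' := by
    rintro x y ⟨hx, hxl, hxr⟩ ⟨hy, hyl, hyr⟩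
    refine ⟨add_mem hx hy, fun a => ?_, fun a => ?_⟩
    · obtain ⟨b, hb⟩ := hxl a
      obtain ⟨c, hc⟩ := hyl a
      exact ⟨b + c, by rw [map_add, hb, hc, add_mul]⟩
    · obtain ⟨b, hb⟩ := hxr a
      obtain ⟨c, hc⟩ := hyr a
      exact ⟨b + c, by rw [map_add, hb, hc, mul_add]⟩
  algebraMap_mem' r := by
    refine ⟨(envelopingVN A).toStarSubalgebra.algebraMap_mem r, fun a => ⟨r • a, ?_⟩,
      fun a => ⟨r • a, ?_⟩⟩
    · rw [map_smul, Algebra.algebraMap_eq_smul_one, smul_mul_assoc, one_mul]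
    · rw [map_smul, Algebra.algebraMap_eq_smul_one, mul_smul_comm, mul_one]
  star_mem' := by
    rintro x ⟨hx, hxl, hxr⟩
    refine ⟨star_mem hx, fun a => ?_, fun a => ?_⟩
    · obtain ⟨b, hb⟩ := hxr (star a)
      exact ⟨star b, by rw [map_star, hb, star_mul, map_star, star_star]⟩
    · obtain ⟨b, hb⟩ := hxl (star a)
      exact ⟨star b, by rw [map_star, hb, star_mul, map_star, star_star]⟩

end Universal

/-! ### Open projections, Cuntz equivalence, precompact supports -/

section Projections

variable {A : Type u} [NonUnitalCStarAlgebra A] [PartialOrder A] [StarOrderedRing A]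

/-- The range projection `p_a` of `a` in `A**`: the orthogonal projection onto the closure of the
range of `a` acting on the universal Hilbert space. -/
noncomputable def rangeProjection (a : A) : UniversalHilbert A →L[ℂ] UniversalHilbert A :=
  (universalRep A a).range.topologicalClosure.starProjection

/-- A `σ`-compact open projection of `A`: the range projection of a positive element of `A`. -/
def IsSigmaCompactOpenProjection (p : UniversalHilbert A →L[ℂ] UniversalHilbert A) : Prop :=
  ∃ a : A, 0 ≤ a ∧ p = rangeProjection a

/-- `Her(p) = p A** p ∩ A`, as a subset of `A`. -/
def Her (p : UniversalHilbert A →L[ℂ] UniversalHilbert A) : Set A :=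
  {b | p * universalRep A b * p = universalRep A b}

/-- `p ≈ q`: some partial isometry `v` in `A**` satisfies `v* v = p`, `v v* = q` and
`v Her(p) v* ⊆ Her(q)`. -/
def CuntzEquivalent (p q : UniversalHilbert A →L[ℂ] UniversalHilbert A) : Prop :=
  ∃ v ∈ envelopingVN A, star v * v = p ∧ v * star v = q ∧
    ∀ a ∈ Her p, ∃ b ∈ Her q, v * universalRep A a * star v = universalRep A b

/-- `a` is a strictly positive element of the hereditary subalgebra `B`: it is a positive element
of `B` and `a B a` is dense in `B`. -/
def IsStrictlyPositiveIn (a : A) (B : Set A) : Prop :=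
  a ∈ B ∧ 0 ≤ a ∧ B ⊆ closure {x | ∃ b ∈ B, x = a * b * a}

/-- For `0 ≤ a` and `0 < t`, the open spectral projection of `a` in `A**` for `(t, ‖a‖]`. Since
the function `x ↦ max (x - t) 0` is positive on `(t, ‖a‖]` and zero on `[0, t]`, this is
the range projection of `(a - t)₊`. -/
noncomputable def openSpectralProjection (a : A) (t : ℝ) :
    UniversalHilbert A →L[ℂ] UniversalHilbert A :=
  rangeProjection (cfcₙ (fun x : ℝ => max (x - t) 0) a)

/-- `pK` is a precompact support of the `σ`-compact open projection `p`: for some strictly positive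
`a` in `Her(p)` and some `tₙ ∈ (0, ‖a‖]` decreasing to `0`, `pK n` is the open spectral projection
of `a` for `(tₙ, ‖a‖]`. -/
def IsPrecompactSupport (p : UniversalHilbert A →L[ℂ] UniversalHilbert A)
    (pK : ℕ → (UniversalHilbert A →L[ℂ] UniversalHilbert A)) : Prop :=
  ∃ (a : A) (t : ℕ → ℝ), IsStrictlyPositiveIn a (Her p) ∧
    (∀ n, t n ∈ Set.Ioc 0 ‖a‖) ∧ Antitone t ∧ Tendsto t atTop (𝓝 0) ∧
    ∀ n, pK n = openSpectralProjection a (t n)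

end Projections

/-!
For `n ≤ m` and `t` beyond both `s n` and `s m`, the operator `w t * pK n` is a scalar multiple of
`w (s n) * pK n` and, since `pK n ≤ pK m`, also of `w (s m) * pK n`. So the unitaries `w (s n)`
agree on the increasing projections `pK n` up to phases, and these phases can be chosen coherently
(`exists_phase`): there are unitary multipliers `V n = c n • w (s n)` with
`V m * pK n = V n * pK n` for `n ≤ m`.

Since `pK n → p` strongly (`IsPrecompactSupport.tendsto`), `V n * pK n` converges strongly to some
`v` with `v* v = p`. The adjoints `(V n)*` are compatible in the same way on the projections
`V n * pK n * (V n)*`, which converge strongly to `q`, so `v v* = q`; and `v` lies in `A**` because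
a von Neumann algebra is closed under strong limits.

Finally let `a` be the strictly positive element defining the support and `f n` its cut-down by the
`n`-th level, so that `pK n` is the range projection of `f n`. Then `v f n = V n f n` belongs to
`A` because `V n` is a multiplier, and `f n → a` in norm. As the range of a `*`-homomorphism of
C*-algebras is closed (`NonUnitalStarAlgHom.isClosed_range`), `v a` belongs to `A`, hence so does
`v a b a v*` for `b` in `Her(p)`, and these elements are dense in `v Her(p) v*`
(`IsPrecompactSupport.mul_mul_star_mem_range`).
-/

/-! ### Ranges of `*`-homomorphisms -/

section ClosedRange

variable {A B : Type*} [NonUnitalCStarAlgebra A] [NonUnitalCStarAlgebra B]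

/-- Self-adjoint elements of the range lift with norm control: cut the given preimage off at
`±‖φ a‖` by functional calculus. -/
theorem NonUnitalStarAlgHom.exists_map_eq_norm_le_of_isSelfAdjoint (φ : A →⋆ₙₐ[ℂ] B) {a : A}
    (ha : IsSelfAdjoint a) : ∃ b, φ b = φ a ∧ ‖b‖ ≤ ‖φ a‖ := by
  set r : ℝ := ‖φ a‖ with hr
  have hr0 : 0 ≤ r := norm_nonneg _
  have hφa : IsSelfAdjoint (φ a) := ha.map φ
  have hf0 : max (-r) (min r 0) = 0 := by simp [hr0]
  refine ⟨cfcₙ (fun x : ℝ => max (-r) (min r x)) a, ?_, norm_cfcₙ_le fun x _ => ?_⟩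
  · have hφ : Continuous φ := AddMonoidHomClass.continuous_of_bound φ 1 fun x => by
      simpa using NonUnitalStarAlgHom.norm_apply_le φ x
    have h : φ (cfcₙ (fun x : ℝ => max (-r) (min r x)) a)
        = cfcₙ (fun x : ℝ => max (-r) (min r x)) (φ a) :=
      (φ.restrictScalars ℝ).map_cfcₙ _ a (by fun_prop) hf0 hφ ha hφa
    rw [h]
    conv_rhs => rw [← cfcₙ_id ℝ (φ a) hφa]
    refine cfcₙ_congr fun x hx => ?_
    have hx' : -r ≤ x ∧ x ≤ r := abs_le.mp
      (NonUnitalIsometricContinuousFunctionalCalculus.norm_quasispectrum_le (φ a) hx hφa)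
    simp only [id, min_eq_right hx'.2, max_eq_right hx'.1]
  · rw [Real.norm_eq_abs, abs_le]
    exact ⟨le_max_left _ _, max_le (by linarith) (min_le_left _ _)⟩

theorem NonUnitalStarAlgHom.exists_map_eq_norm_le (φ : A →⋆ₙₐ[ℂ] B) (a : A) :
    ∃ b, φ b = φ a ∧ ‖b‖ ≤ 2 * ‖φ a‖ := by
  set h : A := (2⁻¹ : ℂ) • (a + star a) with hh
  set k : A := (Complex.I * 2⁻¹) • (a - star a) with hk
  have hhs : IsSelfAdjoint h := by
    simp [isSelfAdjoint_iff, hh, add_comm]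
  have hks : IsSelfAdjoint k := by
    rw [isSelfAdjoint_iff, hk, star_smul, star_sub, star_star]
    rw [show star (Complex.I * 2⁻¹) = -(Complex.I * 2⁻¹) by simp, neg_smul, ← smul_neg, neg_sub]
  have ha : a = h - Complex.I • k := by
    rw [hh, hk, smul_smul, ← mul_assoc, Complex.I_mul_I]
    module
  have hhn : ‖φ h‖ ≤ ‖φ a‖ := by
    rw [hh, map_smul, map_add, map_star, norm_smul]
    have := norm_add_le (φ a) (star (φ a))
    rw [norm_star] at this
    norm_num
    linarith
  have hkn : ‖φ k‖ ≤ ‖φ a‖ := by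
    rw [hk, map_smul, map_sub, map_star, norm_smul]
    have := norm_sub_le (φ a) (star (φ a))
    rw [norm_star] at this
    norm_num
    linarith
  obtain ⟨b, hb, hbn⟩ := φ.exists_map_eq_norm_le_of_isSelfAdjoint hhs
  obtain ⟨c, hc, hcn⟩ := φ.exists_map_eq_norm_le_of_isSelfAdjoint hks
  refine ⟨b - Complex.I • c, ?_, ?_⟩
  · rw [map_sub, map_smul, hb, hc, ← map_smul, ← map_sub, ← ha]
  · have := norm_sub_le b (Complex.I • c)
    rw [norm_smul, Complex.norm_I, one_mul] at this
    linarith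

theorem NonUnitalStarAlgHom.isClosed_range (φ : A →⋆ₙₐ[ℂ] B) : IsClosed (Set.range φ) := by
  let f : NormedAddGroupHom A B :=
    { toFun := φ
      map_add' := map_add φ
      bound' := ⟨1, fun a => by simpa using NonUnitalStarAlgHom.norm_apply_le φ a⟩ }
  have hf : f.SurjectiveOnWith f.range 2 := by
    rintro _ ⟨a, rfl⟩
    exact φ.exists_map_eq_norm_le a
  refine isClosed_of_closure_subset fun y hy => ?_
  obtain ⟨x, hx, -⟩ := controlled_closure_of_complete two_pos one_pos hf y hy
  exact ⟨x, hx⟩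

end ClosedRange

/-! ### Strong limits of compatible partial isometries -/

section StrongLimit

variable {H : Type*} [NormedAddCommGroup H] [InnerProductSpace ℂ H] [CompleteSpace H]

/-- If `P n → p` strongly and the isometries `U n` are compatible, in that `U m` and `U n` agree on
the range of `P n` for `n ≤ m`, then `U n * P n` converges strongly, and the limit `v` satisfies
`v* v = p`. -/
theorem exists_tendsto_mul_of_tendsto {P U : ℕ → H →L[ℂ] H} {p : H →L[ℂ] H}
    (hp : star p * p = p) (hP : ∀ x, Tendsto (fun n => P n x) atTop (𝓝 (p x)))
    (hU : ∀ n, star (U n) * U n = 1) (hUP : ∀ n m, n ≤ m → U m * P n = U n * P n) :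
    ∃ v : H →L[ℂ] H, (∀ x, Tendsto (fun n => (U n * P n) x) atTop (𝓝 (v x))) ∧
      star v * v = p := by
  have hin : ∀ n x y, ⟪U n x, U n y⟫_ℂ = ⟪x, y⟫_ℂ := fun n x y => by
    rw [← ContinuousLinearMap.adjoint_inner_right, ← ContinuousLinearMap.star_eq_adjoint,
      ← mul_apply_eq_comp, hU, one_apply_eq_self]
  have hnorm : ∀ n x, ‖U n x‖ = ‖x‖ := fun n x => by
    rw [@norm_eq_sqrt_re_inner ℂ, hin, ← @norm_eq_sqrt_re_inner ℂ]
  have hlim : ∀ x, ∃ y, Tendsto (fun n => (U n * P n) x) atTop (𝓝 y) := fun x => by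
    refine cauchySeq_tendsto_of_complete (Metric.cauchySeq_iff'.mpr fun ε hε => ?_)
    obtain ⟨N, hN⟩ := Metric.cauchySeq_iff'.mp (hP x).cauchySeq ε hε
    refine ⟨N, fun n hn => ?_⟩
    rw [← hUP N n hn, dist_eq_norm, mul_apply_eq_comp, mul_apply_eq_comp,
      ← map_sub, hnorm, ← dist_eq_norm]
    exact hN n hn
  choose f hf using hlim
  refine ⟨continuousLinearMapOfTendsto (fun n => U n * P n) (tendsto_pi_nhds.mpr hf), hf, ?_⟩
  ext x
  refine ext_inner_right ℂ fun y => ?_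
  rw [mul_apply_eq_comp, ContinuousLinearMap.star_eq_adjoint,
    ContinuousLinearMap.adjoint_inner_left]
  refine tendsto_nhds_unique ((hf x).inner (hf y)) ?_
  simp only [mul_apply_eq_comp, hin]
  have h : ⟪p x, y⟫_ℂ = ⟪p x, p y⟫_ℂ := by
    conv_lhs => rw [← hp]
    have hs : star p = p := by
      conv_lhs => rw [← hp]
      rw [star_mul, star_star, hp]
    rw [mul_apply_eq_comp, hs, ← ContinuousLinearMap.adjoint_inner_right,
      ← ContinuousLinearMap.star_eq_adjoint, hs]
  rw [h]
  exact (hP x).inner (hP y)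

theorem eq_star_of_tendsto {T : ℕ → H →L[ℂ] H} {v u : H →L[ℂ] H}
    (hv : ∀ x, Tendsto (fun n => T n x) atTop (𝓝 (v x)))
    (hu : ∀ x, Tendsto (fun n => star (T n) x) atTop (𝓝 (u x))) : u = star v := by
  ext x
  refine ext_inner_right ℂ fun y => ?_
  rw [ContinuousLinearMap.star_eq_adjoint, ContinuousLinearMap.adjoint_inner_left]
  refine tendsto_nhds_unique ((hu x).inner tendsto_const_nhds) ?_
  simp only [ContinuousLinearMap.star_eq_adjoint, ContinuousLinearMap.adjoint_inner_left]
  exact tendsto_const_nhds.inner (hv y)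

theorem VonNeumannAlgebra.mem_of_tendsto (S : VonNeumannAlgebra H) {T : ℕ → H →L[ℂ] H}
    {v : H →L[ℂ] H} (hT : ∀ n, T n ∈ S)
    (hv : ∀ x, Tendsto (fun n => T n x) atTop (𝓝 (v x))) : v ∈ S := by
  rw [← S.commutant_commutant, VonNeumannAlgebra.mem_commutant_iff]
  intro y hy
  ext x
  refine tendsto_nhds_unique ((y.continuous.tendsto _).comp (hv x)) ?_
  refine (hv (y x)).congr fun n => ?_
  exact (DFunLike.congr_fun (VonNeumannAlgebra.mem_commutant_iff.mp hy _ (hT n)) x :)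

end StrongLimit

/-! ### Range projections and precompact supports -/

section RangeProjection

variable {A : Type u} [NonUnitalCStarAlgebra A] [PartialOrder A] [StarOrderedRing A]

theorem isClosed_range_universalRep : IsClosed (Set.range (universalRep A)) :=
  (universalRep A).isClosed_range

theorem continuous_universalRep : Continuous (universalRep A) :=
  AddMonoidHomClass.continuous_of_bound (universalRep A) 1 fun a => by
    simpa using NonUnitalStarAlgHom.norm_apply_le (universalRep A) a

theorem isStarProjection_rangeProjection (a : A) : IsStarProjection (rangeProjection a) :=
  isStarProjection_starProjection

theorem range_rangeProjection (a : A) :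
    (rangeProjection a).range = (universalRep A a).range.topologicalClosure :=
  Submodule.range_starProjection _

theorem rangeProjection_mul_eq_iff (a : A) (T : UniversalHilbert A →L[ℂ] UniversalHilbert A) :
    rangeProjection a * T = T ↔ T.range ≤ (universalRep A a).range.topologicalClosure := by
  constructor
  · rintro h _ ⟨x, rfl⟩
    rw [← h]
    exact Submodule.starProjection_apply_mem _ _
  · intro h
    ext1 x
    exact Submodule.starProjection_eq_self_iff.mpr (h ⟨x, rfl⟩)

theorem rangeProjection_mul_universalRep (a : A) :
    rangeProjection a * universalRep A a = universalRep A a :=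
  (rangeProjection_mul_eq_iff a _).mpr (Submodule.le_topologicalClosure _)

theorem universalRep_mem_envelopingVN (a : A) : universalRep A a ∈ envelopingVN A := by
  change universalRep A a ∈ StarSubalgebra.centralizer ℂ
    (StarSubalgebra.centralizer ℂ (Set.range (universalRep A)) :
      Set (UniversalHilbert A →L[ℂ] UniversalHilbert A))
  rw [StarSubalgebra.mem_centralizer_iff]
  intro g hg
  have h : ∀ g ∈ StarSubalgebra.centralizer ℂ (Set.range (universalRep A)),
      g * universalRep A a = universalRep A a * g := fun g hg =>
    ((StarSubalgebra.mem_centralizer_iff ℂ).mp hg _ ⟨a, rfl⟩).1.symm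
  exact ⟨h g hg, h _ (star_mem hg)⟩

theorem rangeProjection_mem_envelopingVN (a : A) : rangeProjection a ∈ envelopingVN A := by
  rw [VonNeumannAlgebra.IsStarProjection.mem_iff (isStarProjection_rangeProjection a)]
  intro y hy
  have ha := universalRep_mem_envelopingVN a
  have hc := VonNeumannAlgebra.mem_commutant_iff.mp hy _ ha
  rw [Module.End.mem_invtSubmodule, range_rangeProjection]
  refine Submodule.topologicalClosure_minimal _ ?_
    ((Submodule.isClosed_topologicalClosure _).preimage y.continuous)
  rintro _ ⟨x, rfl⟩
  refine Submodule.le_topologicalClosure _ ⟨y x, ?_⟩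
  exact DFunLike.congr_fun hc x

/-- An operator in the norm closure of the right ideal `π(a) B(H)`, where `π` is the universal
representation, has its range in the closure of the range of `π(a)`. -/
theorem range_le_of_mem_closure {a : A} {T : UniversalHilbert A →L[ℂ] UniversalHilbert A}
    (h : T ∈ closure (Set.range (fun S => universalRep A a * S))) :
    T.range ≤ (universalRep A a).range.topologicalClosure := by
  rw [← rangeProjection_mul_eq_iff]
  have hc : IsClosed {T | rangeProjection a * T = T} :=
    isClosed_eq (by fun_prop) continuous_id
  refine closure_minimal ?_ hc h
  rintro _ ⟨S, rfl⟩
  change rangeProjection a * (universalRep A a * S) = universalRep A a * S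
  rw [← mul_assoc, rangeProjection_mul_universalRep]

theorem universalRep_mem_of_mem_closure {a b : A} {B : Set A}
    (h : b ∈ closure {x | ∃ c ∈ B, x = a * c * a}) :
    universalRep A b ∈ closure (Set.range (fun S => universalRep A a * S)) := by
  refine map_mem_closure continuous_universalRep h ?_
  rintro _ ⟨c, -, rfl⟩
  exact ⟨universalRep A (c * a), by simp only [mul_assoc, map_mul]⟩

theorem mul_universalRep_of_mem_Her {p : UniversalHilbert A →L[ℂ] UniversalHilbert A}
    (hp : p * p = p) {b : A} (hb : b ∈ Her p) : p * universalRep A b = universalRep A b := by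
  rw [← show p * universalRep A b * p = universalRep A b from hb]
  simp only [← mul_assoc, hp]

/-- An open projection is the range projection of every strictly positive element of its
hereditary subalgebra. -/
theorem IsSigmaCompactOpenProjection.eq_rangeProjection
    {p : UniversalHilbert A →L[ℂ] UniversalHilbert A} (hp : IsSigmaCompactOpenProjection p)
    {a : A} (ha : IsStrictlyPositiveIn a (Her p)) : p = rangeProjection a := by
  obtain ⟨e, he, rfl⟩ := hp
  have hproj := isStarProjection_rangeProjection e
  have h1 := mul_universalRep_of_mem_Her hproj.isIdempotentElem ha.1
  have h2 : e ∈ Her (rangeProjection e) := by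
    have h := rangeProjection_mul_universalRep e
    have h' := congrArg star h
    rw [star_mul, ← map_star, (IsSelfAdjoint.of_nonneg he).star_eq,
      hproj.isSelfAdjoint.star_eq] at h'
    change rangeProjection e * universalRep A e * rangeProjection e = universalRep A e
    rw [h, h']
  have h3 := range_le_of_mem_closure (universalRep_mem_of_mem_closure (ha.2.2 h2))
  have h4 : (universalRep A e).range.topologicalClosure
      = (universalRep A a).range.topologicalClosure :=
    le_antisymm
      (Submodule.topologicalClosure_minimal _ h3 (Submodule.isClosed_topologicalClosure _))
      (Submodule.topologicalClosure_minimal _ ((rangeProjection_mul_eq_iff e _).mp h1)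
        (Submodule.isClosed_topologicalClosure _))
  simp only [rangeProjection, h4]

/-- The cut-down `(a - t)₊`, given by functional calculus; it is used for `0 ≤ t` only, the
non-unital calculus being zero for functions that do not vanish at `0`. -/
noncomputable def cutDown (a : A) (t : ℝ) : A :=
  cfcₙ (fun x : ℝ => max (x - t) 0) a

theorem openSpectralProjection_eq (a : A) (t : ℝ) :
    openSpectralProjection a t = rangeProjection (cutDown a t) := rfl

theorem cutDown_zero {a : A} (ha : 0 ≤ a) : cutDown a 0 = a := by
  have hsa : IsSelfAdjoint a := .of_nonneg ha
  rw [cutDown]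
  conv_rhs => rw [← cfcₙ_id ℝ a hsa]
  refine cfcₙ_congr fun x hx => ?_
  simpa using quasispectrum_nonneg_of_nonneg a ha x hx

/-- `(x - t)₊ = (x - s)₊ g(x)` with `g(x) = (x - t)₊ / max (x - s) (t - s)` when `s < t`. -/
theorem exists_cutDown_eq_mul {a : A} (ha : 0 ≤ a) {s t : ℝ} (hs : 0 ≤ s) (hst : s < t) :
    ∃ b, cutDown a t = cutDown a s * b := by
  have hsa : IsSelfAdjoint a := .of_nonneg ha
  have hpos : ∀ x : ℝ, 0 < max (x - s) (t - s) := fun x =>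
    lt_max_of_lt_right (sub_pos.mpr hst)
  refine ⟨cfcₙ (fun x : ℝ => max (x - t) 0 / max (x - s) (t - s)) a, ?_⟩
  rw [cutDown, cutDown, ← cfcₙ_mul (fun x : ℝ => max (x - s) 0)
    (fun x : ℝ => max (x - t) 0 / max (x - s) (t - s)) a (by fun_prop) (by simp [hs])
    (Continuous.continuousOn (by
      refine Continuous.div (by fun_prop) (by fun_prop) fun x => (hpos x).ne'))
    (by simp [hs.trans hst.le])]
  congr 1
  ext x
  rcases le_total x t with h | h
  · simp [max_eq_right (sub_nonpos.mpr h)]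
  · have h1 : 0 < x - s := by linarith
    rw [max_eq_left (show t - s ≤ x - s by linarith), max_eq_left h1.le]
    field_simp

theorem norm_sub_cutDown_le {a : A} (ha : 0 ≤ a) {t : ℝ} (ht : 0 ≤ t) :
    ‖cutDown a t - a‖ ≤ t := by
  have hsa : IsSelfAdjoint a := .of_nonneg ha
  conv_lhs =>
    enter [1, 2]
    rw [← cfcₙ_id ℝ a hsa]
  rw [cutDown, ← cfcₙ_sub _ _ a (by fun_prop) (by simp [ht]) (by fun_prop) (by simp)]
  refine norm_cfcₙ_le fun x hx => ?_
  have hx := quasispectrum_nonneg_of_nonneg a ha x hx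
  rw [Real.norm_eq_abs, abs_le, id]
  constructor
  · linarith [le_max_left (x - t) 0]
  · rcases max_cases (x - t) 0 with h | h <;> linarith

theorem range_cutDown_le {a : A} (ha : 0 ≤ a) {s t : ℝ} (hs : 0 ≤ s) (hst : s ≤ t) :
    (universalRep A (cutDown a t)).range ≤ (universalRep A (cutDown a s)).range := by
  rcases hst.eq_or_lt with rfl | hst
  · exact le_rfl
  · obtain ⟨b, hb⟩ := exists_cutDown_eq_mul ha hs hst
    rw [hb, map_mul]
    rintro _ ⟨x, rfl⟩
    exact ⟨universalRep A b x, rfl⟩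

theorem tendsto_cutDown {a : A} (ha : 0 ≤ a) {t : ℕ → ℝ} (ht : ∀ n, 0 ≤ t n)
    (hlim : Tendsto t atTop (𝓝 0)) : Tendsto (fun n => cutDown a (t n)) atTop (𝓝 a) :=
  tendsto_iff_norm_sub_tendsto_zero.mpr
    (squeeze_zero (fun _ => norm_nonneg _) (fun n => norm_sub_cutDown_le ha (ht n)) hlim)

theorem openSpectralProjection_mul {a : A} (ha : 0 ≤ a) {s t : ℝ} (hs : 0 ≤ s) (hst : s ≤ t) :
    openSpectralProjection a s * openSpectralProjection a t = openSpectralProjection a t := by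
  rw [openSpectralProjection_eq, openSpectralProjection_eq, rangeProjection_mul_eq_iff,
    range_rangeProjection]
  exact Submodule.topologicalClosure_mono (range_cutDown_le ha hs hst)

theorem tendsto_openSpectralProjection {a : A} (ha : 0 ≤ a) {t : ℕ → ℝ} (ht : ∀ n, 0 ≤ t n)
    (hanti : Antitone t) (hlim : Tendsto t atTop (𝓝 0)) (x : UniversalHilbert A) :
    Tendsto (fun n => openSpectralProjection a (t n) x) atTop (𝓝 (rangeProjection a x)) := by
  set U : ℕ → Submodule ℂ (UniversalHilbert A) := fun n =>
    (universalRep A (cutDown a (t n))).range.topologicalClosure with hU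
  have hmono : Monotone U := fun n m hnm =>
    Submodule.topologicalClosure_mono (range_cutDown_le ha (ht m) (hanti hnm))
  have hsup : (⨆ n, U n).topologicalClosure = (universalRep A a).range.topologicalClosure := by
    refine le_antisymm ?_ ?_
    · refine Submodule.topologicalClosure_minimal _ (iSup_le fun n => ?_)
        (Submodule.isClosed_topologicalClosure _)
      refine Submodule.topologicalClosure_mono ?_
      simpa only [cutDown_zero ha] using range_cutDown_le ha le_rfl (ht n)
    · refine Submodule.topologicalClosure_minimal _ ?_ (Submodule.isClosed_topologicalClosure _)
      rintro _ ⟨y, rfl⟩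
      have h : Tendsto (fun n => universalRep A (cutDown a (t n)) y) atTop
          (𝓝 (universalRep A a y)) :=
        (((ContinuousLinearMap.apply ℂ _ y).continuous.comp
          continuous_universalRep).tendsto a).comp (tendsto_cutDown ha ht hlim)
      refine mem_closure_of_tendsto h (Eventually.of_forall fun n => ?_)
      exact Submodule.mem_iSup_of_mem n (Submodule.le_topologicalClosure _ ⟨y, rfl⟩)
  have h := Submodule.starProjection_tendsto_closure_iSup U hmono x
  simp only [hsup] at h
  exact h

theorem IsPrecompactSupport.tendsto {p : UniversalHilbert A →L[ℂ] UniversalHilbert A}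
    {pK : ℕ → (UniversalHilbert A →L[ℂ] UniversalHilbert A)} (h : IsPrecompactSupport p pK)
    (hp : IsSigmaCompactOpenProjection p) (x : UniversalHilbert A) :
    Tendsto (fun n => pK n x) atTop (𝓝 (p x)) := by
  obtain ⟨a, t, ha, ht, hanti, hlim, hpK⟩ := h
  simp only [hpK, hp.eq_rangeProjection ha]
  exact tendsto_openSpectralProjection ha.2.1 (fun n => (ht n).1.le) hanti hlim x

theorem IsPrecompactSupport.isStarProjection {p : UniversalHilbert A →L[ℂ] UniversalHilbert A}
    {pK : ℕ → (UniversalHilbert A →L[ℂ] UniversalHilbert A)} (h : IsPrecompactSupport p pK)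
    (n : ℕ) : IsStarProjection (pK n) := by
  obtain ⟨a, t, -, -, -, -, hpK⟩ := h
  rw [hpK]
  exact isStarProjection_rangeProjection _

theorem IsPrecompactSupport.mul_eq {p : UniversalHilbert A →L[ℂ] UniversalHilbert A}
    {pK : ℕ → (UniversalHilbert A →L[ℂ] UniversalHilbert A)} (h : IsPrecompactSupport p pK)
    {n m : ℕ} (hnm : n ≤ m) : pK m * pK n = pK n := by
  obtain ⟨a, t, ha, ht, hanti, -, hpK⟩ := h
  rw [hpK, hpK]
  exact openSpectralProjection_mul ha.2.1 (ht m).1.le (hanti hnm)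

theorem IsPrecompactSupport.mem_envelopingVN
    {p : UniversalHilbert A →L[ℂ] UniversalHilbert A}
    {pK : ℕ → (UniversalHilbert A →L[ℂ] UniversalHilbert A)} (h : IsPrecompactSupport p pK)
    (n : ℕ) : pK n ∈ envelopingVN A := by
  obtain ⟨a, t, -, -, -, -, hpK⟩ := h
  rw [hpK]
  exact rangeProjection_mem_envelopingVN _

end RangeProjection

/-! ### Adjusting the phases -/

section Phase

variable {E : Type*} [CStarAlgebra E]

/-- Unitaries `W n` that agree up to scalars on an increasing sequence of projections can be
multiplied by phases so that they agree exactly: normalise all of them on the first nonzero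
projection. -/
theorem exists_phase {W P : ℕ → E} (hW : ∀ n, W n ∈ unitary E)
    (hP : ∀ n m, n ≤ m → P m * P n = P n)
    (h : ∀ n m, n ≤ m → ∃ c : ℂ, W m * P n = c • (W n * P n)) :
    ∃ c : ℕ → ℂ, (∀ n, ‖c n‖ = 1) ∧
      ∀ n m, n ≤ m → (c m • W m) * P n = (c n • W n) * P n := by
  classical
  by_cases hall : ∀ n, P n = 0
  · exact ⟨fun _ => 1, by simp, by simp [hall]⟩
  push Not at hall
  set k := Nat.find hall with hk
  have hPk : P k ≠ 0 := Nat.find_spec hall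
  have hlt : ∀ n, n < k → P n = 0 := fun n hn => not_not.mp (Nat.find_min hall hn)
  have hnorm : ∀ n, ‖W n * P k‖ = ‖P k‖ := fun n =>
    CStarRing.norm_mem_unitary_mul _ (hW n)
  have hne : W k * P k ≠ 0 := norm_ne_zero_iff.mp (by rw [hnorm]; exact norm_ne_zero_iff.mpr hPk)
  choose! d hd using fun m (hm : k ≤ m) => h k m hm
  have hd1 : ∀ m, k ≤ m → ‖d m‖ = 1 := fun m hm => by
    have := congrArg norm (hd m hm)
    rw [norm_smul, hnorm, hnorm] at this
    exact (mul_eq_right₀ (norm_ne_zero_iff.mpr hPk)).mp this.symm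
  refine ⟨fun m => if k ≤ m then (d m)⁻¹ else 1, fun m => ?_, fun n m hnm => ?_⟩
  · by_cases hm : k ≤ m
    · simp [hm, hd1 m hm]
    · simp [hm]
  rcases lt_or_ge n k with hn | hn
  · rw [hlt n hn, mul_zero, mul_zero]
  have hm := hn.trans hnm
  obtain ⟨e, he⟩ := h n m hnm
  have hdn : d n ≠ 0 := norm_ne_zero_iff.mp (by rw [hd1 n hn]; exact one_ne_zero)
  have hdm : d m ≠ 0 := norm_ne_zero_iff.mp (by rw [hd1 m hm]; exact one_ne_zero)
  have hde : d m = e * d n := by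
    have h1 := congrArg (· * P k) he
    simp only [smul_mul_assoc, mul_assoc, hP k n hn] at h1
    rw [hd m hm, hd n hn, smul_smul] at h1
    exact smul_left_injective ℂ hne h1
  simp only [hn, hm, if_true, smul_mul_assoc]
  rw [he, smul_smul, hde]
  congr 1
  have : e ≠ 0 := fun h0 => hdm (by rw [hde, h0, zero_mul])
  field_simp

/-- Both `w t * P n` with `t` beyond `s n` and `s m` are compared with `w (s n) * P n` and with
`w (s m) * P n`; the second scalar is nonzero unless `P n = 0`. -/
theorem exists_mul_eq_smul_of_path {w : ℝ → E} {P : ℕ → E} {s : ℕ → ℝ}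
    (hw : ∀ t ∈ Set.Ico (0 : ℝ) 1, w t ∈ unitary E) (hs : ∀ n, s n ∈ Set.Ioo (0 : ℝ) 1)
    (hP : ∀ n m, n ≤ m → P m * P n = P n)
    (h : ∀ n, ∀ t ∈ Set.Ico (s n) 1, ∃ c : ℂ, w t * P n = c • (w (s n) * P n))
    (n m : ℕ) (hnm : n ≤ m) : ∃ c : ℂ, w (s m) * P n = c • (w (s n) * P n) := by
  have ht : max (s n) (s m) < 1 := max_lt (hs n).2 (hs m).2
  obtain ⟨c, hc⟩ := h n _ ⟨le_max_left _ _, ht⟩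
  obtain ⟨d, hd⟩ := h m _ ⟨le_max_right _ _, ht⟩
  replace hd := congrArg (· * P n) hd
  simp only [smul_mul_assoc, mul_assoc, hP n m hnm] at hd
  by_cases hd0 : d = 0
  · have hPn : P n = 0 := by
      rw [hd0, zero_smul] at hd
      have hu := hw _ ⟨(hs n).1.le.trans (le_max_left _ (s m)), ht⟩
      rw [← norm_eq_zero, ← CStarRing.norm_mem_unitary_mul _ hu, hd, norm_zero]
    exact ⟨0, by simp [hPn]⟩
  · refine ⟨d⁻¹ * c, ?_⟩
    rw [mul_smul, ← hc, hd, smul_smul, inv_mul_cancel₀ hd0, one_smul]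

end Phase

/-! ### The implementing partial isometry -/

section Limit

variable {A : Type u} [NonUnitalCStarAlgebra A] [PartialOrder A] [StarOrderedRing A]

/-- If unitary multipliers `V n` agree on the projections of a precompact support, and `v` agrees
with `V n` on the `n`-th projection, then `v` maps the strictly positive element, hence all of
`Her(p)`, into `A`: cut-downs `b` of `a` satisfy `v b = V n b`, which lies in `A`. -/
theorem IsPrecompactSupport.mul_mul_star_mem_range
    {p : UniversalHilbert A →L[ℂ] UniversalHilbert A}
    {pK : ℕ → (UniversalHilbert A →L[ℂ] UniversalHilbert A)} (h : IsPrecompactSupport p pK)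
    {V : ℕ → (UniversalHilbert A →L[ℂ] UniversalHilbert A)}
    (hV : ∀ n, V n ∈ multiplierAlgebra A)
    {v : UniversalHilbert A →L[ℂ] UniversalHilbert A} (hv : ∀ n, v * pK n = V n * pK n)
    {b : A} (hb : b ∈ Her p) :
    v * universalRep A b * star v ∈ Set.range (universalRep A) := by
  obtain ⟨a, t, ha, ht, -, hlim, hpK⟩ := h
  have hclosed := isClosed_range_universalRep (A := A)
  have hva : v * universalRep A a ∈ Set.range (universalRep A) := by
    have hc : Continuous fun x => v * universalRep A x :=
      continuous_const.mul continuous_universalRep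
    refine hclosed.mem_of_tendsto
      ((hc.tendsto a).comp (tendsto_cutDown ha.2.1 (fun n => (ht n).1.le) hlim))
      (Eventually.of_forall fun n => ?_)
    have h1 := rangeProjection_mul_universalRep (cutDown a (t n))
    rw [← openSpectralProjection_eq, ← hpK] at h1
    change v * universalRep A (cutDown a (t n)) ∈ _
    rw [← h1, ← mul_assoc, hv, mul_assoc, h1]
    exact (hV n).2.1 _
  obtain ⟨d, hd⟩ := hva
  have hsa : star a = a := (IsSelfAdjoint.of_nonneg ha.2.1).star_eq
  have hd' : star (universalRep A d) = universalRep A a * star v := by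
    rw [hd, star_mul, ← map_star, hsa]
  have hc : Continuous fun x => v * universalRep A x * star v :=
    (continuous_const.mul continuous_universalRep).mul continuous_const
  refine closure_minimal (t := {x | v * universalRep A x * star v ∈ Set.range (universalRep A)})
    ?_ (hclosed.preimage hc) (ha.2.2 hb)
  rintro _ ⟨c, -, rfl⟩
  refine ⟨d * c * star d, ?_⟩
  rw [map_mul, map_mul, map_star, hd', hd]
  simp only [map_mul, mul_assoc]

end Limit


theorem proposition2p8 {A : Type u} [NonUnitalCStarAlgebra A] [PartialOrder A] [StarOrderedRing A]
    (p q : UniversalHilbert A →L[ℂ] UniversalHilbert A)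
    (hp : IsSigmaCompactOpenProjection p) (hq : IsSigmaCompactOpenProjection q)
    (w : ℝ → (UniversalHilbert A →L[ℂ] UniversalHilbert A))
    (hwM : ∀ t ∈ Set.Ico (0 : ℝ) 1, w t ∈ multiplierAlgebra A ∧
      w t ∈ unitary (UniversalHilbert A →L[ℂ] UniversalHilbert A))
    (hw : ContinuousOn w (Set.Ico 0 1)) (hw0 : w 0 = 1)
    (pK : ℕ → (UniversalHilbert A →L[ℂ] UniversalHilbert A)) (hpK : IsPrecompactSupport p pK)
    (s : ℕ → ℝ) (hs : ∀ n, s n ∈ Set.Ioo (0 : ℝ) 1)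
    (hfix : ∀ n, ∀ t ∈ Set.Ico (s n) 1,
      w t * pK n * star (w t) = w (s n) * pK n * star (w (s n)))
    (hqK : IsPrecompactSupport q (fun n => w (s n) * pK n * star (w (s n))))
    (hscalar : ∀ n, ∀ t ∈ Set.Ico (s n) 1, ∃ c : ℂ, w t * pK n = c • (w (s n) * pK n)) :
    CuntzEquivalent p q := by

  have hmono : ∀ n m, n ≤ m → pK m * pK n = pK n := fun n m hnm => hpK.mul_eq hnm
  have hsI : ∀ n, s n ∈ Set.Ico (0 : ℝ) 1 := fun n => ⟨(hs n).1.le, (hs n).2⟩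
  obtain ⟨c, hc1, hc⟩ := exists_phase (W := fun n => w (s n)) (fun n => (hwM _ (hsI n)).2) hmono
    (exists_mul_eq_smul_of_path (fun t ht => (hwM t ht).2) hs hmono hscalar)
  set V : ℕ → (UniversalHilbert A →L[ℂ] UniversalHilbert A) := fun n => c n • w (s n) with hVdef
  have hcc : ∀ n, star (c n) * c n = 1 := fun n => by
    rw [Complex.star_def, Complex.conj_mul', hc1]; norm_num
  have hVM : ∀ n, V n ∈ multiplierAlgebra A := fun n =>
    (multiplierAlgebra A).smul_mem (hwM _ (hsI n)).1 _
  have hVu : ∀ n, star (V n) * V n = 1 := fun n => by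
    rw [hVdef]
    simp only [star_smul, smul_mul_smul_comm, hcc, one_smul]
    exact (hwM _ (hsI n)).2.1
  have hVu' : ∀ n, V n * star (V n) = 1 := fun n => by
    rw [hVdef]
    simp only [star_smul, smul_mul_smul_comm, mul_comm (c n), hcc, one_smul]
    exact (hwM _ (hsI n)).2.2
  have hqV : ∀ n, w (s n) * pK n * star (w (s n)) = V n * pK n * star (V n) := fun n => by
    rw [hVdef]
    simp only [star_smul, smul_mul_assoc, mul_smul_comm, smul_smul, hcc, one_smul]
  simp only [hqV] at hqK
  have hproj : ∀ {r : UniversalHilbert A →L[ℂ] UniversalHilbert A},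
      IsSigmaCompactOpenProjection r → star r * r = r := by
    rintro _ ⟨a, -, rfl⟩
    have := isStarProjection_rangeProjection a
    rw [this.isSelfAdjoint.star_eq, this.isIdempotentElem.eq]
  obtain ⟨v, hvlim, hvp⟩ := exists_tendsto_mul_of_tendsto (hproj hp) (hpK.tendsto hp) hVu hc
  have hstar : ∀ n, star (V n) * (V n * pK n * star (V n)) = pK n * star (V n) := fun n => by
    rw [← mul_assoc, ← mul_assoc, hVu, one_mul]
  -- The adjoints agree on the projections `V n * pK n * (V n)*`, so they converge strongly too.
  obtain ⟨u, hulim, huq⟩ := exists_tendsto_mul_of_tendsto (U := fun n => star (V n)) (hproj hq)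
    (hqK.tendsto hq) (fun n => by rw [star_star, hVu']) (fun n m hnm => by
      rw [hstar, ← hc n m hnm, ← mul_assoc, ← mul_assoc, hVu, one_mul])
  have huv : u = star v := eq_star_of_tendsto hvlim fun x => (hulim x).congr fun n => by
    rw [hstar, star_mul, (hpK.isStarProjection n).isSelfAdjoint.star_eq]
  have hvq : v * star v = q := by rw [← huq, huv, star_star]
  have hvV : ∀ n, v * pK n = V n * pK n := fun n => by
    ext1 x
    refine tendsto_nhds_unique (hvlim (pK n x)) ?_
    refine tendsto_const_nhds.congr' ((eventually_ge_atTop n).mono fun m hm => ?_)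
    change (V n * pK n) x = (V m * (pK m * pK n)) x
    rw [hmono n m hm, hc n m hm]
  refine ⟨v, ?_, hvp, hvq, fun b hb => ?_⟩
  · exact VonNeumannAlgebra.mem_of_tendsto _
      (fun n => mul_mem (hVM n).1 (hpK.mem_envelopingVN n)) hvlim
  · obtain ⟨d, hd⟩ := hpK.mul_mul_star_mem_range hVM hvV hb
    refine ⟨d, ?_, hd.symm⟩
    change q * universalRep A d * q = universalRep A d
    have hb' : p * universalRep A b * p = universalRep A b := hb
    calc q * universalRep A d * q
        = v * (star v * v * universalRep A b * (star v * v)) * star v := by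
          rw [hd, ← hvq]; simp only [mul_assoc]
      _ = universalRep A d := by rw [hvp, hb', hd]
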